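/- **Theorem (second-order sufficient conditions).** Let $\Omega\subset\mathbb{R}^d$, $d\ge 1$, be a bounded domain, $\nu>0$, $y_d\in L^2(\Omega)$, $u_d\in L^\infty(\Omega)$, and write $(\cdot,\cdot)$ for the $L^2(\Omega)$ scalar product, $\langle\cdot,\cdot\rangle$ for the pairing of $H^{-1}(\Omega)$ and $H^1_0(\Omega)$ (with $L^2(\Omega)\subset H^{-1}(\Omega)$ via $(\cdot,\cdot)$), and $a(y,v)=(\nabla y,\nabla v)$. For $u\in H^{-1}(\Omega)$ let $S(u)=y\in H^1_0(\Omega)$ be the unique solution of $$a(y,v-y)+\|v\|_{L^1(\Omega)}-\|y\|_{L^1(\Omega)}\ge\langle u,v-y\rangle\quad\forall v\in H^1_0(\Omega),$$ and let $Q(u)=q\in L^\infty(\Omega)\subset H^{-1}(\Omega)$ be the slack variable, i.e. the unique $q$ with $a(y,v)+(q,v)=\langle u,v\rangle$ for all $v\in H^1_0(\Omega)$ and $q\,y=|y|$, $|q|\le 1$ a.e. in $\Omega$. For $u\in L^2(\Omega)$ put $f(u)=\tfrac12\|S(u)-y_d\|_{L^2(\Omega)}^2+\tfrac{\nu}{2}\|u-u_d\|_{L^2(\Omega)}^2$.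 Let $\bar u\in L^2(\Omega)$, $\bar y=S(\bar u)$, $\bar q=Q(\bar u)$, and assume: 1. (Regularity) $\bar y\in C^1(\Omega)$. 2. (Structure of the active set) There is a closed set $\mathcal{C}\subseteq\Gamma:=\partial\{\bar y\ne0\}\cup\partial\Omega$ of $H^1(\mathbb{R}^d)$-capacity zero such that $\Gamma\setminus\mathcal{C}$ is a strong $(d-1)$-dimensional Lipschitz submanifold of $\mathbb{R}^d$ (locally the graph of a Lipschitz function of $d-1$ variables) and the sets $\mathcal{N}_+=(\{\nabla\bar y=0\}\cap\partial\{\bar y>0\})\setminus\mathcal{C}$ and $\mathcal{N}_-=(\{\nabla\bar y=0\}\cap\partial\{\bar y<0\})\setminus\mathcal{C}$ are relatively open in $\Gamma\setminus\mathcal{C}$. 3. The set $\mathcal{M}=\{x\in\Omega:\bar y(x)=0,\ \nabla\bar y(x)\ne0\}$ is empty. 4. (Strong stationarity) $\bar p\in H^1_0(\Omega)$ and $\bar\mu\in H^{-1}(\Omega)$ satisfy $$\bar p+\nu(\bar u-u_d)=0\ \text{ a.e. in }\Omega,\qquad a(\bar p,v)=(\bar y-y_d,v)-\langle\bar\mu,v\rangle\quad\forall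 v\in H^1_0(\Omega),$$ $$\bar p\in\mathcal{K}(\bar y),\qquad\langle\bar\mu,v\rangle\ge0\quad\forall v\in\mathcal{K}(\bar y),$$ where $\mathcal{K}(\bar y)$ is the set of all $v\in H^1_0(\Omega)$ with $|v|=\bar q\,v$ a.e. on $\{\bar y=0\}$ whose positive part $v^+=\max(v,0)$ has zero trace a.e. on $\mathcal{N}_-$ and whose negative part $v^-=\max(-v,0)$ has zero trace a.e. on $\mathcal{N}_+$. 5. (Sign condition) There is $\epsilon>0$ such that for all $u\in L^2(\Omega)$ with $\|u-\bar u\|_{L^2(\Omega)}\le\epsilon$, $$\langle\bar\mu,S(u)-\bar y\rangle-\langle Q(u)-\bar q,\bar p\rangle\ge0.$$ Then $\bar u$ satisfies the quadratic growth condition: there are $\epsilon',\delta>0$ such that $$f(\bar u)\le f(u)-\delta\|u-\bar u\|_{L^2(\Omega)}^2\qquad\text{for all }u\in L^2(\Omega)\text{ with }\|u-\bar u\|_{L^2(\Omega)}\le\epsilon'.$$ -/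

import Mathlib

open MeasureTheory Filter Topology
open scoped ContDiff ENNReal NNReal

noncomputable section

namespace EllipticVI

/-- The Euclidean space `ℝ^d`. -/
abbrev Euc (d : ℕ) : Type := EuclideanSpace ℝ (Fin d)

variable {d : ℕ}

/-- `L²(Ω)`. -/
abbrev L2 (Ω : Set (Euc d)) : Type := Lp ℝ 2 (volume.restrict Ω)

/-- `L²(Ω) × L²(Ω; ℝ^d)` with the Hilbert norm `‖(v, g)‖² = ‖v‖² + ‖g‖²`. On pairs `(v, ∇v)` this
is the `H¹(Ω)` norm. -/
abbrev L2Pair (Ω : Set (Euc d)) : Type :=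
  WithLp 2 (Lp ℝ 2 (volume.restrict Ω) × Lp (Euc d) 2 (volume.restrict Ω))

/-- `φ ∈ C_c^∞(Ω)`. -/
def IsTestFunction (Ω : Set (Euc d)) (φ : Euc d → ℝ) : Prop :=
  ContDiff ℝ ∞ φ ∧ HasCompactSupport φ ∧ tsupport φ ⊆ Ω

/-- `w = (φ, ∇φ)` almost everywhere in `Ω`. -/
def RepresentsFun (Ω : Set (Euc d)) (w : L2Pair Ω) (φ : Euc d → ℝ) : Prop :=
  w.fst =ᵐ[volume.restrict Ω] φ ∧ w.snd =ᵐ[volume.restrict Ω] gradient φ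

/-- `H₀¹(Ω)`: the closure of the test functions in the `H¹(Ω)` norm. An element is the pair
`(v, ∇v)` of a function and its weak gradient. -/
def H01 (Ω : Set (Euc d)) : Submodule ℝ (L2Pair Ω) :=
  (Submodule.span ℝ
    {w : L2Pair Ω | ∃ φ : Euc d → ℝ, IsTestFunction Ω φ ∧ RepresentsFun Ω w φ}).topologicalClosure

/-- The embedding `H₀¹(Ω) → L²(Ω)`. -/
def valL (Ω : Set (Euc d)) : H01 Ω →L[ℝ] L2 Ω :=
  (WithLp.fstL 2 ℝ (Lp ℝ 2 (volume.restrict Ω)) (Lp (Euc d) 2 (volume.restrict Ω))).comp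
    (H01 Ω).subtypeL

/-- The weak gradient `H₀¹(Ω) → L²(Ω; ℝ^d)`. -/
def gradL (Ω : Set (Euc d)) : H01 Ω →L[ℝ] Lp (Euc d) 2 (volume.restrict Ω) :=
  (WithLp.sndL 2 ℝ (Lp ℝ 2 (volume.restrict Ω)) (Lp (Euc d) 2 (volume.restrict Ω))).comp
    (H01 Ω).subtypeL

/-- The bilinear form `a(y, v) = (∇y, ∇v)`. -/
def aForm (Ω : Set (Euc d)) (y v : H01 Ω) : ℝ := inner ℝ (gradL Ω y) (gradL Ω v)

/-- `H⁻¹(Ω)`. -/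
abbrev Hneg1 (Ω : Set (Euc d)) : Type := StrongDual ℝ (H01 Ω)

/-- The embedding `L²(Ω) → H⁻¹(Ω)`, `g ↦ (g, ·)`. -/
def l2ToDual (Ω : Set (Euc d)) (g : L2 Ω) : Hneg1 Ω := (innerSL ℝ g).comp (valL Ω)

/-- The norm of `L¹(Ω)`; for bounded `Ω` every element of `L²(Ω)` is integrable. -/
def l1Norm (Ω : Set (Euc d)) (v : L2 Ω) : ℝ := ∫ x in Ω, |v x|

/-- `y` solves the variational inequality of the second kind with right-hand side `ℓ`. -/
def SolvesVI (Ω : Set (Euc d)) (ℓ : Hneg1 Ω) (y : H01 Ω) : Prop :=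
  ∀ v : H01 Ω,
    ℓ (v - y) ≤ aForm Ω y (v - y) + l1Norm Ω (valL Ω v) - l1Norm Ω (valL Ω y)

/-- The solution operator `S : H⁻¹(Ω) → H₀¹(Ω)` of the variational inequality. -/
def solOp (Ω : Set (Euc d)) (ℓ : Hneg1 Ω) : H01 Ω := Classical.epsilon (SolvesVI Ω ℓ)

/-- `q` is a slack variable for `(ℓ, y)`. The bound `|q| ≤ 1` puts `q` into `L^∞(Ω)`. -/
def IsSlack (Ω : Set (Euc d)) (ℓ : Hneg1 Ω) (y : H01 Ω) (q : L2 Ω) : Prop :=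
  (∀ v : H01 Ω, aForm Ω y v + inner ℝ q (valL Ω v) = ℓ v) ∧
    ∀ᵐ x ∂(volume.restrict Ω), q x * valL Ω y x = |valL Ω y x| ∧ |q x| ≤ 1

/-- The slack variable associated with `S(ℓ)`, as a function on `Ω`. -/
def slack (Ω : Set (Euc d)) (ℓ : Hneg1 Ω) : L2 Ω :=
  Classical.epsilon (IsSlack Ω ℓ (solOp Ω ℓ))

/-- The operator `Q : H⁻¹(Ω) → H⁻¹(Ω)` mapping `ℓ` to its slack variable. -/
def slackOp (Ω : Set (Euc d)) (ℓ : Hneg1 Ω) : Hneg1 Ω := l2ToDual Ω (slack Ω ℓ)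

/-- The objective `J(y, u)`. -/
def objective (Ω : Set (Euc d)) (ν : ℝ) (yd ud : L2 Ω) (y : H01 Ω) (u : L2 Ω) : ℝ :=
  1 / 2 * ‖valL Ω y - yd‖ ^ 2 + ν / 2 * ‖u - ud‖ ^ 2

/-- The reduced objective `f(u) = J(S(u), u)`. -/
def reducedObjective (Ω : Set (Euc d)) (ν : ℝ) (yd ud : L2 Ω) (u : L2 Ω) : ℝ :=
  objective Ω ν yd ud (solOp Ω (l2ToDual Ω u)) u

/-- The quadratic growth condition for `f` at `ubar`. -/
def QuadraticGrowth (Ω : Set (Euc d)) (ν : ℝ) (yd ud ubar : L2 Ω) : Prop :=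
  ∃ ε > (0 : ℝ), ∃ δ > (0 : ℝ), ∀ u : L2 Ω, ‖u - ubar‖ ≤ ε →
    reducedObjective Ω ν yd ud ubar ≤ reducedObjective Ω ν yd ud u - δ * ‖u - ubar‖ ^ 2

/-- `w = (v, g)` lies in `H¹(Ω)`, that is, `g` is the weak gradient of `v`. -/
def MemH1 (Ω : Set (Euc d)) (w : L2Pair Ω) : Prop :=
  ∀ φ : Euc d → ℝ, IsTestFunction Ω φ →
    ∫ x in Ω, w.fst x • gradient φ x = -∫ x in Ω, φ x • w.snd x

/-- The `H¹(ℝ^d)`-capacity: the infimum of `‖v‖²` in `H¹(ℝ^d)` over all `v` with `v ≥ 1` a.e. in an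
open neighbourhood of `A`. -/
def h1Capacity (A : Set (Euc d)) : ℝ≥0∞ :=
  ⨅ (w : L2Pair (Set.univ : Set (Euc d))) (_ : MemH1 Set.univ w)
    (_ : ∃ U : Set (Euc d), IsOpen U ∧ A ⊆ U ∧ ∀ᵐ x, x ∈ U → 1 ≤ w.fst x),
    ENNReal.ofReal (‖w‖ ^ 2)

/-- Strong `(d-1)`-dimensional Lipschitz submanifold of `ℝ^d`: near each of its points, `A` is the
graph, in the direction of a unit vector `e`, of a Lipschitz function on the hyperplane `e^⊥`. -/
def IsStrongLipschitzSubmanifold (A : Set (Euc d)) : Prop :=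
  ∀ x ∈ A, ∃ e : Euc d, ‖e‖ = 1 ∧ ∃ U : Set (Euc d), IsOpen U ∧ x ∈ U ∧
    ∃ (g : ((ℝ ∙ e)ᗮ : Submodule ℝ (Euc d)) → ℝ) (L : ℝ≥0), LipschitzWith L g ∧
      A ∩ U = {z ∈ U | inner ℝ e z = g ((ℝ ∙ e)ᗮ.orthogonalProjectionOnto z)}

/-- The `(d-1)`-dimensional surface measure on `ℝ^d`, for `d ≥ 1`. -/
def surfaceMeasure (d : ℕ) : Measure (Euc d) := Measure.euclideanHausdorffMeasure (d - 1)

/-- `t` is the trace of `z ∈ H₀¹(Ω)` on `A ⊆ Ω`: the continuous extension from test functions `φ`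
to `H₀¹(Ω)` of the restriction `φ ↦ φ|_A` into `L²_loc(A)` with respect to surface measure. -/
def HasTrace (Ω A : Set (Euc d)) (z : H01 Ω) (t : Euc d → ℝ) : Prop :=
  AEStronglyMeasurable t ((surfaceMeasure d).restrict A) ∧
  ∃ (φ : ℕ → Euc d → ℝ) (w : ℕ → H01 Ω),
    (∀ n, IsTestFunction Ω (φ n) ∧ RepresentsFun Ω (w n : L2Pair Ω) (φ n)) ∧
    Tendsto w atTop (𝓝 z) ∧
    ∀ K ⊆ A, IsCompact K →
      Tendsto (fun n => eLpNorm (φ n - t) 2 ((surfaceMeasure d).restrict K)) atTop (𝓝 0)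

/-- The trace of `z` on `A` vanishes almost everywhere on `A`. -/
def TraceVanishes (Ω A : Set (Euc d)) (z : H01 Ω) : Prop :=
  ∃ t : Euc d → ℝ, HasTrace Ω A z t ∧ t =ᵐ[(surfaceMeasure d).restrict A] 0

/-- `{x ∈ Ω : y(x) ≠ 0}`. -/
def inactiveSet (Ω : Set (Euc d)) (Y : Euc d → ℝ) : Set (Euc d) := {x ∈ Ω | Y x ≠ 0}

/-- `∂{y ≠ 0} ∪ ∂Ω`. -/
def freeBoundary (Ω : Set (Euc d)) (Y : Euc d → ℝ) : Set (Euc d) :=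
  frontier (inactiveSet Ω Y) ∪ frontier Ω

/-- `M = {x ∈ Ω : y(x) = 0, ∇y(x) ≠ 0}`. -/
def setM (Ω : Set (Euc d)) (Y : Euc d → ℝ) : Set (Euc d) := {x ∈ Ω | Y x = 0 ∧ gradient Y x ≠ 0}

/-- `N₊ = ({∇y = 0} ∩ ∂{y > 0}) \ C`. -/
def setNPos (Ω : Set (Euc d)) (Y : Euc d → ℝ) (C : Set (Euc d)) : Set (Euc d) :=
  ({x ∈ Ω | gradient Y x = 0} ∩ frontier {x ∈ Ω | 0 < Y x}) \ C

/-- `N₋ = ({∇y = 0} ∩ ∂{y < 0}) \ C`. -/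
def setNNeg (Ω : Set (Euc d)) (Y : Euc d → ℝ) (C : Set (Euc d)) : Set (Euc d) :=
  ({x ∈ Ω | gradient Y x = 0} ∩ frontier {x ∈ Ω | Y x < 0}) \ C

/-- `A` is relatively open in `B`. -/
def IsRelOpen (A B : Set (Euc d)) : Prop := ∃ O : Set (Euc d), IsOpen O ∧ A = O ∩ B

/-- The structural assumption on the active set, with exceptional set `C`. -/
structure ActiveSetStructure (Ω : Set (Euc d)) (Y : Euc d → ℝ) (C : Set (Euc d)) : Prop where
  subset : C ⊆ freeBoundary Ω Y
  closed : IsClosed C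
  capacity : h1Capacity C = 0
  lipschitz : IsStrongLipschitzSubmanifold (freeBoundary Ω Y \ C)
  relOpen_pos : IsRelOpen (setNPos Ω Y C) (freeBoundary Ω Y \ C)
  relOpen_neg : IsRelOpen (setNNeg Ω Y C) (freeBoundary Ω Y \ C)

/-- The space `W_y`: those `z ∈ H₀¹(Ω)` with `∫_M (tr z)² / ‖∇y‖ ds < ∞`. -/
def spaceW (Ω : Set (Euc d)) (Y : Euc d → ℝ) : Set (H01 Ω) :=
  {z | ∃ t : Euc d → ℝ, HasTrace Ω (setM Ω Y) z t ∧
    ∫⁻ x in setM Ω Y, ENNReal.ofReal (t x ^ 2 / ‖gradient Y x‖) ∂(surfaceMeasure d) < ⊤}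

/-- The cone `K(y)`: all `v ∈ W_y` with `|v| = q v` a.e. on `{y = 0}`, with `tr (v⁺) = 0` a.e. on
`N₋` and `tr (v⁻) = 0` a.e. on `N₊`; here `v⁺ = max (v, 0)` and `v⁻ = max (-v, 0)`. -/
def coneK (Ω : Set (Euc d)) (Y : Euc d → ℝ) (C : Set (Euc d)) (q : L2 Ω) : Set (H01 Ω) :=
  {v | v ∈ spaceW Ω Y ∧
    (∀ᵐ x ∂(volume.restrict Ω), Y x = 0 → |valL Ω v x| = q x * valL Ω v x) ∧
    (∃ vp : H01 Ω, (valL Ω vp =ᵐ[volume.restrict Ω] fun x => max (valL Ω v x) 0) ∧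
      TraceVanishes Ω (setNNeg Ω Y C) vp) ∧
    (∃ vm : H01 Ω, (valL Ω vm =ᵐ[volume.restrict Ω] fun x => max (-valL Ω v x) 0) ∧
      TraceVanishes Ω (setNPos Ω Y C) vm)}

/-- The strong stationarity system for the control `u`, the state `y` (with `C¹` representative `Y`),
the slack variable `q`, the adjoint state `p` and a multiplier `mu ∈ H⁻¹(Ω)`. -/
structure StrongStationarity (Ω : Set (Euc d)) (ν : ℝ) (yd ud u : L2 Ω) (y : H01 Ω)
    (Y : Euc d → ℝ) (C : Set (Euc d)) (q : L2 Ω) (p : H01 Ω) (mu : Hneg1 Ω) : Prop where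
  gradient_eq : valL Ω p + ν • (u - ud) = 0
  adjoint_eq : ∀ v ∈ spaceW Ω Y, ∀ tp tv : Euc d → ℝ,
    HasTrace Ω (setM Ω Y) p tp → HasTrace Ω (setM Ω Y) v tv →
    aForm Ω p v + 2 * ∫ x in setM Ω Y, tp x * tv x / ‖gradient Y x‖ ∂(surfaceMeasure d)
      = inner ℝ (valL Ω y - yd) (valL Ω v) - mu v
  adjoint_mem : p ∈ coneK Ω Y C q
  multiplier_nonneg : ∀ v ∈ coneK Ω Y C q, 0 ≤ mu v

end EllipticVI

end

/-! Since `S` and `Q` enter through exact equations, no derivative of `S` is needed. With `y = S(u)`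
and `q = Q(u)`, expanding the squares of `f(u) - f(ubar)` leaves `½‖y - ybar‖² + (ν/2)‖u - ubar‖²`
plus the linear terms `(ybar - yd, y - ybar) + ν(ubar - ud, u - ubar)`. The adjoint equation tested
with `y - ybar`, the relation `p = -ν(ubar - ud)` and the two state equations tested with `p` turn
these into `⟨mu, y - ybar⟩ - ⟨q - qbar, p⟩`; the terms `a(p, y - ybar)` cancel. The sign condition
makes this nonnegative, so growth holds with `δ = ν/2` on the same ball (`objective_growth`).

The rest shows that the state equations hold for the chosen values of `S` and `Q` (`isSlack_slack`).
Existence comes from a projection in the dual problem (`exists_primal_dual_pair`), uniqueness of the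
state from the Poincaré inequality. -/

namespace EllipticVI

/-! ### Hilbert space arguments: growth estimate and duality. -/

section Duality

variable {H E L : Type*} [NormedAddCommGroup H] [InnerProductSpace ℝ H]
  [NormedAddCommGroup E] [InnerProductSpace ℝ E]
  [NormedAddCommGroup L] [InnerProductSpace ℝ L]

/-- Adding the two inequalities cancels `ℓ` and `N`, leaving `‖D (z - y)‖² ≤ 0`; `N` may be any
function. -/
theorem map_eq_zero_of_variational_inequalities (D : H →L[ℝ] E) (N : H → ℝ) (ℓ : StrongDual ℝ H)
    {y z : H} (hy : ℓ (z - y) ≤ inner ℝ (D y) (D (z - y)) + N z - N y)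
    (hz : ℓ (y - z) ≤ inner ℝ (D z) (D (y - z)) + N y - N z) : D (z - y) = 0 := by
  rw [← neg_sub z y, map_neg, map_neg, inner_neg_right] at hz
  have h : inner ℝ (D (z - y)) (D (z - y)) =
      inner ℝ (D z) (D (z - y)) - inner ℝ (D y) (D (z - y)) := by
    rw [← inner_sub_left, ← map_sub]
  exact real_inner_self_nonpos.1 (by linarith)

/-- Expansion of a tracking objective around a stationary point: the remainder is nonnegative if the
multipliers satisfy the sign condition. -/
theorem objective_growth (D : H →L[ℝ] E) (V : H →L[ℝ] L) {ν : ℝ} {yd ud u ubar q qbar : L}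
    {y ybar p : H} {mu : StrongDual ℝ H} (hp : V p = -(ν • (ubar - ud)))
    (hu : inner ℝ (D y) (D p) + inner ℝ q (V p) = inner ℝ u (V p))
    (hubar : inner ℝ (D ybar) (D p) + inner ℝ qbar (V p) = inner ℝ ubar (V p))
    (hadj : inner ℝ (D p) (D (y - ybar)) = inner ℝ (V ybar - yd) (V (y - ybar)) - mu (y - ybar))
    (hsign : 0 ≤ mu (y - ybar) - (inner ℝ q (V p) - inner ℝ qbar (V p))) :
    1 / 2 * ‖V ybar - yd‖ ^ 2 + ν / 2 * ‖ubar - ud‖ ^ 2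
      ≤ 1 / 2 * ‖V y - yd‖ ^ 2 + ν / 2 * ‖u - ud‖ ^ 2 - ν / 2 * ‖u - ubar‖ ^ 2 := by
  have ha : inner ℝ (D p) (D (y - ybar)) = inner ℝ (D y) (D p) - inner ℝ (D ybar) (D p) := by
    rw [map_sub, inner_sub_right, real_inner_comm, real_inner_comm (D ybar)]
  have hpu : inner ℝ u (V p) - inner ℝ ubar (V p) = -(ν * inner ℝ (ubar - ud) (u - ubar)) := by
    rw [← inner_sub_left, hp, inner_neg_right, real_inner_smul_right, real_inner_comm]
  have hy : ‖V y - yd‖ ^ 2 = ‖V ybar - yd‖ ^ 2 + 2 * inner ℝ (V ybar - yd) (V (y - ybar))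
      + ‖V (y - ybar)‖ ^ 2 := by
    rw [← norm_add_sq_real, map_sub, sub_add_sub_cancel']
  have hU : ‖u - ud‖ ^ 2 = ‖ubar - ud‖ ^ 2 + 2 * inner ℝ (ubar - ud) (u - ubar)
      + ‖u - ubar‖ ^ 2 := by
    rw [← norm_add_sq_real, sub_add_sub_cancel']
  rw [hy, hU]
  linarith [sq_nonneg ‖V (y - ybar)‖]

variable [CompleteSpace H] [CompleteSpace E] [CompleteSpace L]

/-- The polar set of a function `N` dominated by the norm is weakly compact, so that its image under
a bounded operator is closed. -/
theorem isClosed_image_polar (N : L → ℝ) (c : ℝ) (hN : ∀ w, N w ≤ c * ‖w‖) (A : L →L[ℝ] E) :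
    IsClosed (A '' {q : L | ∀ w, inner ℝ q w ≤ N w}) := by
  let K : Set (WeakDual ℝ L) := {φ | ∀ w, φ w ≤ N w}
  have hcl : IsClosed K := by
    have : K = ⋂ w, {φ : WeakDual ℝ L | φ w ≤ N w} := by ext; simp [K]
    rw [this]
    exact isClosed_iInter fun w => isClosed_le (WeakDual.eval_continuous w) continuous_const
  have hK : IsCompact K := by
    refine (WeakDual.isCompact_closedBall 0 (max c 0)).of_isClosed_subset hcl fun φ hφ => ?_
    simp only [Set.mem_preimage, mem_closedBall_zero_iff]
    refine ContinuousLinearMap.opNorm_le_bound _ (le_max_right _ _) fun w => ?_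
    have h1 := (hφ w).trans (hN w)
    have h2 := (hφ (-w)).trans (hN (-w))
    rw [map_neg, norm_neg] at h2
    have h3 : c * ‖w‖ ≤ max c 0 * ‖w‖ :=
      mul_le_mul_of_nonneg_right (le_max_left _ _) (norm_nonneg _)
    exact abs_le.2 ⟨by change _ ≤ φ w; linarith, by change φ w ≤ _; linarith⟩
  -- `Ψ` is `A` followed by the pairing with `E`, valued in functions on `E` with pointwise
  -- topology. The image of the compact `K` is closed there, and the norm-continuous `ι` pulls this
  -- back to `E`.
  let Ψ : WeakDual ℝ L → E → ℝ := fun φ e => φ (A.adjoint e)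
  have hΨ : Continuous Ψ := continuous_pi fun e => WeakDual.eval_continuous _
  have hclosed : IsClosed (Ψ '' K) := (hK.image hΨ).isClosed
  let ι : E → E → ℝ := fun e f => inner ℝ e f
  have hι : Continuous ι := continuous_pi fun f => by fun_prop
  convert hclosed.preimage hι using 1
  ext e
  constructor
  · rintro ⟨q, hq, rfl⟩
    refine ⟨StrongDual.toWeakDual (innerSL ℝ q), fun w => hq w, ?_⟩
    funext f
    exact ContinuousLinearMap.adjoint_inner_right A q f
  · rintro ⟨φ, hφ, he⟩
    let q : L := (InnerProductSpace.toDual ℝ L).symm (WeakDual.toStrongDual φ)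
    have hq : ∀ w, inner ℝ q w = φ w := fun w => InnerProductSpace.toDual_symm_apply
    refine ⟨q, fun w => (hq w).trans_le (hφ w), ext_inner_right ℝ fun f => ?_⟩
    rw [← ContinuousLinearMap.adjoint_inner_right, hq]
    exact congrFun he f

/-- Existence of a primal-dual pair for a variational inequality of the second kind, in abstract
form. -/
theorem exists_primal_dual_pair (D : H →L[ℝ] E) (V : H →L[ℝ] L) (κ : ℝ)
    (hD : ∀ v, ‖v‖ ≤ κ * ‖D v‖) (N : L → ℝ) (c : ℝ) (hN0 : ∀ w, 0 ≤ N w)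
    (hN : ∀ w, N w ≤ c * ‖w‖) (ℓ : StrongDual ℝ H) :
    ∃ (y : H) (q : L), (∀ v, inner ℝ (D y) (D v) + inner ℝ q (V v) = ℓ v) ∧
      (∀ w, inner ℝ q w ≤ N w) ∧
      ∀ q' : L, (∀ w, inner ℝ q' w ≤ N w) → inner ℝ q' (V y) ≤ inner ℝ q (V y) := by
  let B : H →L[ℝ] H →L[ℝ] ℝ := (innerSL ℝ : E →L[ℝ] E →L[ℝ] ℝ).bilinearComp D D
  have hB : ∀ u v, B u v = inner ℝ (D u) (D v) := fun u v => rfl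
  have hco : IsCoercive B := by
    -- The `+ 1` keeps the constant defined and positive when `κ = 0`.
    refine ⟨(κ ^ 2 + 1)⁻¹, by positivity, fun u => ?_⟩
    rw [hB, real_inner_self_eq_norm_sq, mul_assoc, inv_mul_le_iff₀ (by positivity)]
    have h1 : ‖u‖ * ‖u‖ ≤ (κ * ‖D u‖) * (κ * ‖D u‖) :=
      mul_self_le_mul_self (norm_nonneg _) (hD u)
    nlinarith [sq_nonneg ‖D u‖]
  let Φ := hco.continuousLinearEquivOfBilin
  have hΦ : ∀ f v, inner ℝ (D (Φ.symm f)) (D v) = inner ℝ f v := fun f v => by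
    rw [← hB, ← hco.continuousLinearEquivOfBilin_apply]
    exact congrArg (inner ℝ · v) (Φ.apply_symm_apply f)
  let x₀ : H := Φ.symm ((InnerProductSpace.toDual ℝ H).symm ℓ)
  have hx₀ : ∀ v, inner ℝ (D x₀) (D v) = ℓ v := fun v => by
    rw [hΦ, InnerProductSpace.toDual_symm_apply]
  let R : L →L[ℝ] H := (Φ.symm : H →L[ℝ] H).comp V.adjoint
  have hR : ∀ q v, inner ℝ (D (R q)) (D v) = inner ℝ q (V v) := fun q v =>
    (hΦ _ v).trans (ContinuousLinearMap.adjoint_inner_left V v q)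
  let K : Set L := {q | ∀ w, inner ℝ q w ≤ N w}
  have hKc : Convex ℝ K := by
    intro a ha b hb s t hs ht hst w
    rw [inner_add_left, real_inner_smul_left, real_inner_smul_left]
    calc s * inner ℝ a w + t * inner ℝ b w ≤ s * N w + t * N w :=
          add_le_add (mul_le_mul_of_nonneg_left (ha w) hs) (mul_le_mul_of_nonneg_left (hb w) ht)
      _ = N w := by rw [← add_mul, hst, one_mul]
  have himc : Convex ℝ ((D.comp R) '' K) := hKc.linear_image (D.comp R).toLinearMap
  -- Dual problem: project `x₀` onto `R '' K` in the energy norm. With `y = x₀ - R q`, the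
  -- variational characterization of the projection says exactly that `q` maximizes `(·, V y)` over
  -- `K`.
  obtain ⟨_, ⟨q, hq, rfl⟩, hmin⟩ := exists_norm_eq_iInf_of_complete_convex
    (K := (D.comp R) '' K) ⟨_, 0, fun w => by simpa using hN0 w, rfl⟩
    (isClosed_image_polar N c hN (D.comp R)).isComplete himc (D x₀)
  have hvar := (norm_eq_iInf_iff_real_inner_le_zero himc ⟨q, hq, rfl⟩).1 hmin
  refine ⟨x₀ - R q, q, fun v => ?_, hq, fun q' hq' => ?_⟩
  · rw [map_sub, inner_sub_left, hx₀, hR]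
    ring
  · have h := hvar _ ⟨q', hq', rfl⟩
    have e : inner ℝ (D x₀ - (D.comp R) q) ((D.comp R) q' - (D.comp R) q)
        = inner ℝ (q' - q) (V (x₀ - R q)) := by
      rw [← hR, real_inner_comm]
      simp only [ContinuousLinearMap.comp_apply, map_sub]
    rw [e, inner_sub_left] at h
    linarith

end Duality

/-! ### Density of test functions, and traces. -/

section TestFunctions

variable {d : ℕ} {Ω : Set (Euc d)}

theorem IsTestFunction.zero : IsTestFunction Ω (0 : Euc d → ℝ) :=
  ⟨contDiff_const, HasCompactSupport.zero, by simp [tsupport]⟩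

theorem IsTestFunction.add {φ ψ : Euc d → ℝ} (hφ : IsTestFunction Ω φ)
    (hψ : IsTestFunction Ω ψ) : IsTestFunction Ω (φ + ψ) :=
  ⟨hφ.1.add hψ.1, hφ.2.1.add hψ.2.1,
    (tsupport_add φ ψ).trans (Set.union_subset hφ.2.2 hψ.2.2)⟩

theorem IsTestFunction.const_smul {φ : Euc d → ℝ} (c : ℝ) (hφ : IsTestFunction Ω φ) :
    IsTestFunction Ω (c • φ) :=
  ⟨hφ.1.const_smul c, hφ.2.1.smul_left (f := fun _ => c),
    (tsupport_smul_subset_right (fun _ => c) φ).trans hφ.2.2⟩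

theorem IsTestFunction.differentiable {φ : Euc d → ℝ} (hφ : IsTestFunction Ω φ) :
    Differentiable ℝ φ := hφ.1.differentiable (by simp)

theorem RepresentsFun.zero : RepresentsFun Ω 0 (0 : Euc d → ℝ) := by
  refine ⟨Lp.coeFn_zero _ _ _, ?_⟩
  rw [show gradient (0 : Euc d → ℝ) = 0 from gradient_const' (F := Euc d) (0 : ℝ)]
  exact Lp.coeFn_zero _ _ _

theorem RepresentsFun.add {w z : L2Pair Ω} {φ ψ : Euc d → ℝ} (hw : RepresentsFun Ω w φ)
    (hz : RepresentsFun Ω z ψ) (hφ : Differentiable ℝ φ) (hψ : Differentiable ℝ ψ) :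
    RepresentsFun Ω (w + z) (φ + ψ) := by
  refine ⟨(Lp.coeFn_add _ _).trans (hw.1.add hz.1), (Lp.coeFn_add _ _).trans ?_⟩
  filter_upwards [hw.2, hz.2] with x h1 h2
  refine (congrArg₂ (· + ·) h1 h2).trans ?_
  simp only [gradient, fderiv_add (hφ x) (hψ x), map_add]

theorem RepresentsFun.const_smul {w : L2Pair Ω} {φ : Euc d → ℝ} (c : ℝ)
    (hw : RepresentsFun Ω w φ) (hφ : Differentiable ℝ φ) :
    RepresentsFun Ω (c • w) (c • φ) := by
  refine ⟨(Lp.coeFn_smul _ _).trans (hw.1.const_smul c), (Lp.coeFn_smul _ _).trans ?_⟩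
  filter_upwards [hw.2] with x h1
  refine (congrArg (c • ·) h1).trans ?_
  simp [gradient, fderiv_const_smul (hφ x)]

/-- Every element of `H₀¹(Ω)` is a limit of test functions. -/
theorem coe_H01 : (H01 Ω : Set (L2Pair Ω)) =
    closure {w | ∃ φ : Euc d → ℝ, IsTestFunction Ω φ ∧ RepresentsFun Ω w φ} := by
  rw [H01, Submodule.topologicalClosure_coe]
  congr 1
  refine Set.Subset.antisymm (fun w hw => ?_) Submodule.subset_span
  induction hw using Submodule.span_induction with
  | mem w h => exact h
  | zero => exact ⟨0, .zero, .zero⟩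
  | add w z _ _ hw hz =>
    obtain ⟨φ, h1, h2⟩ := hw
    obtain ⟨ψ, h3, h4⟩ := hz
    exact ⟨_, h1.add h3, h2.add h4 h1.differentiable h3.differentiable⟩
  | smul c w _ hw =>
    obtain ⟨φ, h1, h2⟩ := hw
    exact ⟨_, h1.const_smul c, h2.const_smul c h1.differentiable⟩

/-- Only an approximating sequence of test functions is needed; the convergence on compact subsets
of `∅` is void. -/
theorem hasTrace_empty (z : H01 Ω) : HasTrace Ω ∅ z 0 := by
  have hz : (z : L2Pair Ω) ∈ closure
      {w | ∃ φ : Euc d → ℝ, IsTestFunction Ω φ ∧ RepresentsFun Ω w φ} := coe_H01 ▸ z.2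
  obtain ⟨w, hw, hlim⟩ := mem_closure_iff_seq_limit.1 hz
  choose φ hφ using hw
  refine ⟨aestronglyMeasurable_const, φ,
    fun n => ⟨w n, Submodule.le_topologicalClosure _ (Submodule.subset_span ⟨φ n, hφ n⟩)⟩, hφ,
    tendsto_subtype_rng.2 hlim, fun K hK _ => ?_⟩
  simp [Set.subset_empty_iff.1 hK]

end TestFunctions

/-! ### The Poincaré inequality. -/

section Poincare

variable {d : ℕ} {Ω : Set (Euc d)}

theorem norm_sq_eq_integral_of_ae {α F : Type*} [MeasurableSpace α] {μ : Measure α}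
    [NormedAddCommGroup F] [InnerProductSpace ℝ F] (f : Lp F 2 μ) {g : α → F} (h : f =ᵐ[μ] g) :
    ‖f‖ ^ 2 = ∫ x, ‖g x‖ ^ 2 ∂μ := by
  rw [← real_inner_self_eq_norm_sq, L2.inner_def]
  refine integral_congr_ae ?_
  filter_upwards [h] with x hx
  rw [hx, real_inner_self_eq_norm_sq]

theorem IsTestFunction.continuous_gradient {φ : Euc d → ℝ} (hφ : IsTestFunction Ω φ) :
    Continuous (gradient φ) :=
  (InnerProductSpace.toDual ℝ (Euc d)).symm.continuous.comp (hφ.1.continuous_fderiv (by simp))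

theorem tsupport_gradient_subset (φ : Euc d → ℝ) :
    tsupport (gradient φ) ⊆ tsupport φ := by
  refine (closure_mono fun x hx => ?_).trans (tsupport_fderiv_subset ℝ (f := φ))
  contrapose! hx
  simp only [Function.mem_support, not_not] at hx
  simp [gradient, hx]

/-- Integration by parts of `∫ φ² ∂ᵢ xᵢ` bounds `φ` by its gradient. -/
theorem IsTestFunction.integral_sq_le {φ : Euc d → ℝ} (hφ : IsTestFunction Ω φ) (i : Fin d)
    {R : ℝ} (hR : ∀ x ∈ Ω, ‖x‖ ≤ R) :
    ∫ x, ‖φ x‖ ^ 2 ≤ 4 * R ^ 2 * ∫ x, ‖gradient φ x‖ ^ 2 := by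
  let c : Euc d →L[ℝ] ℝ := EuclideanSpace.proj i
  let e : Euc d := EuclideanSpace.single i 1
  have hce : c e = 1 := by simp [c, e]
  have hdiff := hφ.differentiable
  have hcont := hdiff.continuous
  have hgcont := hφ.continuous_gradient
  have hcs : HasCompactSupport (gradient φ) :=
    hφ.2.1.of_isClosed_subset (isClosed_tsupport _) (tsupport_gradient_subset φ)
  have hgrad : ∀ x, fderiv ℝ φ x e = inner ℝ (gradient φ x) e := fun x => by
    simp [gradient]
  have hfd : ∀ x, fderiv ℝ (fun x => φ x * φ x) x e = 2 * (φ x * inner ℝ (gradient φ x) e) := by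
    intro x
    rw [fderiv_fun_mul (hdiff x) (hdiff x)]
    simp only [add_apply, smul_apply, hgrad, smul_eq_mul]
    ring
  have hcφ : HasCompactSupport fun x => φ x * φ x := hφ.2.1.mul_right
  have I1 : Integrable fun x => φ x * φ x :=
    (hcont.mul hcont).integrable_of_hasCompactSupport hcφ
  have I2 : Integrable fun x => c x * (2 * (φ x * inner ℝ (gradient φ x) e)) := by
    refine Continuous.integrable_of_hasCompactSupport (by fun_prop) ?_
    exact HasCompactSupport.mul_left (HasCompactSupport.mul_left hφ.2.1.mul_right)
  have I3 : Integrable fun x => c x * (φ x * φ x) :=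
    Continuous.integrable_of_hasCompactSupport (by fun_prop) (HasCompactSupport.mul_left hcφ)
  have I4 : Integrable fun x => ‖gradient φ x‖ ^ 2 := by
    refine Continuous.integrable_of_hasCompactSupport (by fun_prop) ?_
    exact hcs.comp_left (g := fun z : Euc d => ‖z‖ ^ 2) (by simp)
  have key : ∫ x, c x * (2 * (φ x * inner ℝ (gradient φ x) e)) = -∫ x, φ x * φ x := by
    have h := integral_mul_fderiv_eq_neg_fderiv_mul_of_integrable (μ := volume)
      (f := fun x => c x) (g := fun x => φ x * φ x) (v := e)
      (by simpa [hce] using I1) (by simpa only [hfd] using I2) I3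
      (fun x _ => c.differentiableAt) (fun x _ => (hdiff x).mul (hdiff x))
    simpa [hfd, hce] using h
  -- The difference of the two sides is at least `½(φ + 2 c ∂φ)²`, as `|c| ≤ R` on `Ω`; by `key` the
  -- right side integrates to zero.
  have hpt : ∀ x, φ x * φ x / 2 - 2 * R ^ 2 * ‖gradient φ x‖ ^ 2 ≤
      φ x * φ x + c x * (2 * (φ x * inner ℝ (gradient φ x) e)) := by
    intro x
    by_cases hx : x ∈ Ω
    · have h1 : |c x| ≤ R := by
        refine le_trans ?_ (hR x hx)
        simpa [c] using PiLp.norm_apply_le x i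
      have h2 : |(inner ℝ (gradient φ x) e : ℝ)| ≤ ‖gradient φ x‖ := by
        simpa [e] using abs_real_inner_le_norm (gradient φ x) e
      have h3 : (c x * inner ℝ (gradient φ x) e) ^ 2 ≤ (R * ‖gradient φ x‖) ^ 2 := by
        rw [← sq_abs, abs_mul]
        exact pow_le_pow_left₀ (by positivity)
          (mul_le_mul h1 h2 (abs_nonneg _) ((abs_nonneg _).trans h1)) 2
      nlinarith [sq_nonneg (φ x + 2 * (c x * inner ℝ (gradient φ x) e))]
    · have h0 : φ x = 0 := image_eq_zero_of_notMem_tsupport fun h => hx (hφ.2.2 h)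
      rw [h0]
      have : 0 ≤ 2 * R ^ 2 * ‖gradient φ x‖ ^ 2 := by positivity
      simpa using this
  have hint := integral_mono ((I1.div_const 2).sub (I4.const_mul (2 * R ^ 2))) (I1.add I2) hpt
  simp only [Pi.sub_apply, Pi.add_apply] at hint
  rw [integral_sub (I1.div_const 2) (I4.const_mul _), integral_add I1 I2, key, integral_div,
    integral_const_mul] at hint
  simp only [Real.norm_eq_abs, sq_abs, pow_two (φ _)]
  linarith

/-- The Poincaré inequality on a bounded set. -/
theorem exists_norm_le_mul_norm_gradL (hd : 1 ≤ d) (hΩ : Bornology.IsBounded Ω) :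
    ∃ κ : ℝ, ∀ v : H01 Ω, ‖v‖ ≤ κ * ‖gradL Ω v‖ := by
  obtain ⟨R, hR⟩ := hΩ.exists_norm_le
  have key : ∀ w ∈ H01 Ω, ‖w.fst‖ ^ 2 ≤ 4 * R ^ 2 * ‖w.snd‖ ^ 2 := by
    have hcl : IsClosed {w : L2Pair Ω | ‖w.fst‖ ^ 2 ≤ 4 * R ^ 2 * ‖w.snd‖ ^ 2} := by
      refine isClosed_le ?_ ?_ <;> fun_prop
    intro w hw
    rw [← SetLike.mem_coe, coe_H01] at hw
    refine closure_minimal ?_ hcl hw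
    rintro w ⟨φ, hφ, h1, h2⟩
    have hz : ∀ x, x ∉ Ω → φ x = 0 := fun x hx =>
      image_eq_zero_of_notMem_tsupport fun h => hx (hφ.2.2 h)
    have hz' : ∀ x, x ∉ Ω → gradient φ x = 0 := fun x hx =>
      image_eq_zero_of_notMem_tsupport fun h => hx (hφ.2.2 (tsupport_gradient_subset φ h))
    rw [Set.mem_ofPred_eq, norm_sq_eq_integral_of_ae _ h1, norm_sq_eq_integral_of_ae _ h2,
      setIntegral_eq_integral_of_forall_compl_eq_zero fun x hx => by simp [hz x hx],
      setIntegral_eq_integral_of_forall_compl_eq_zero fun x hx => by simp [hz' x hx]]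
    exact hφ.integral_sq_le ⟨0, hd⟩ hR
  refine ⟨√(4 * R ^ 2 + 1), fun v => ?_⟩
  refine le_of_sq_le_sq ?_ (by positivity)
  rw [mul_pow, Real.sq_sqrt (by positivity), Submodule.coe_norm, WithLp.prod_norm_sq_eq_of_L2]
  have := key v v.2
  change _ ≤ (4 * R ^ 2 + 1) * ‖(v : L2Pair Ω).snd‖ ^ 2
  linarith

end Poincare

/-! ### The slack variable and well-posedness of the variational inequality. -/

section Slack

variable {d : ℕ} {Ω : Set (Euc d)}

theorem l1Norm_nonneg (w : L2 Ω) : 0 ≤ l1Norm Ω w :=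
  integral_nonneg fun _ => abs_nonneg _

theorem SolvesVI.unique (hd : 1 ≤ d) (hΩ : Bornology.IsBounded Ω) {ℓ : Hneg1 Ω} {y z : H01 Ω}
    (hy : SolvesVI Ω ℓ y) (hz : SolvesVI Ω ℓ z) : y = z := by
  obtain ⟨κ, hκ⟩ := exists_norm_le_mul_norm_gradL hd hΩ
  have h0 := map_eq_zero_of_variational_inequalities (gradL Ω) (fun v => l1Norm Ω (valL Ω v)) ℓ
    (hy z) (hz y)
  have h := hκ (z - y)
  rw [h0, norm_zero, mul_zero, norm_le_zero_iff, sub_eq_zero] at h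
  exact h.symm

variable [IsFiniteMeasure (volume.restrict Ω)]

theorem integrable_abs_L2 (w : L2 Ω) : Integrable (fun x => |w x|) (volume.restrict Ω) :=
  ((Lp.memLp w).integrable one_le_two).abs

/-- Cauchy–Schwarz against the constant function one. -/
theorem l1Norm_le (w : L2 Ω) :
    l1Norm Ω w ≤ ‖Lp.const 2 (volume.restrict Ω) (1 : ℝ)‖ * ‖w‖ := by
  rw [← norm_abs_eq_norm w]
  refine le_trans (le_of_eq ?_) (real_inner_le_norm _ _)
  rw [l1Norm, L2.inner_def]
  refine integral_congr_ae ?_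
  filter_upwards [Lp.coeFn_const 2 (volume.restrict Ω) (1 : ℝ), Lp.coeFn_abs w] with x h1 h2
  rw [h1, h2]
  simp

/-- The polar of the `L¹` norm in `L²` is the unit ball of `L^∞`. -/
theorem forall_inner_le_l1Norm_iff (q : L2 Ω) :
    (∀ w, inner ℝ q w ≤ l1Norm Ω w) ↔ ∀ᵐ x ∂(volume.restrict Ω), |q x| ≤ 1 := by
  have hq := (Lp.memLp q).integrable one_le_two
  constructor
  · intro h
    -- Test with `s · 1_A` for measurable `A` and `s = ±1`.
    have hle : ∀ s : ℝ, |s| = 1 → ∀ᵐ x ∂(volume.restrict Ω), s * q x ≤ 1 := by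
      intro s hs
      refine ae_le_of_forall_setIntegral_le (hq.const_mul s) (integrable_const 1)
        fun A hA hA' => ?_
      have hAe := indicatorConstLp_coeFn (μ := volume.restrict Ω) (p := 2) (hs := hA)
        (hμs := hA'.ne) (c := s)
      have h1 := h (indicatorConstLp 2 hA hA'.ne s)
      have e1 : inner ℝ q (indicatorConstLp 2 hA hA'.ne s)
          = ∫ x in A, s * q x ∂(volume.restrict Ω) := by
        rw [L2.inner_def, ← integral_indicator hA]
        refine integral_congr_ae ?_
        filter_upwards [hAe] with x hx
        by_cases hxA : x ∈ A <;> simp [hx, hxA]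
      have e2 : l1Norm Ω (indicatorConstLp 2 hA hA'.ne s)
          = ∫ x in A, (1 : ℝ) ∂(volume.restrict Ω) := by
        rw [l1Norm, ← integral_indicator hA]
        refine integral_congr_ae ?_
        filter_upwards [hAe] with x hx
        by_cases hxA : x ∈ A <;> simp [hx, hxA, hs]
      rwa [e1, e2] at h1
    filter_upwards [hle 1 (by simp), hle (-1) (by simp)] with x h1 h2
    exact abs_le.2 ⟨by linarith, by linarith⟩
  · intro h w
    rw [L2.inner_def]
    refine integral_mono_ae (L2.integrable_inner q w) (integrable_abs_L2 w) ?_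
    filter_upwards [h] with x hx
    calc inner ℝ (q x) (w x) ≤ |q x| * |w x| := real_inner_le_norm _ _
      _ ≤ |w x| := mul_le_of_le_one_left (abs_nonneg _) hx

/-- Since `q y ≤ |y|` pointwise, equal integrals force equality a.e. -/
theorem inner_eq_l1Norm_iff {q y : L2 Ω} (hq : ∀ᵐ x ∂(volume.restrict Ω), |q x| ≤ 1) :
    inner ℝ q y = l1Norm Ω y ↔ ∀ᵐ x ∂(volume.restrict Ω), q x * y x = |y x| := by
  have hin : ∀ x, inner ℝ (q x) (y x) = q x * y x := fun x => by simp [mul_comm]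
  have hi : Integrable (fun x => q x * y x) (volume.restrict Ω) := by
    simpa only [hin] using L2.integrable_inner (𝕜 := ℝ) q y
  simp only [L2.inner_def, l1Norm, hin]
  refine integral_eq_iff_of_ae_le hi (integrable_abs_L2 y) ?_
  filter_upwards [hq] with x hx
  calc q x * y x ≤ |q x| * |y x| := (le_abs_self _).trans_eq (abs_mul _ _)
    _ ≤ |y x| := mul_le_of_le_one_left (abs_nonneg _) hx

/-- `L^∞` functions of norm at most one attain the `L¹` norm. -/
theorem exists_inner_eq_l1Norm (y : L2 Ω) :
    ∃ q : L2 Ω, (∀ w, inner ℝ q w ≤ l1Norm Ω w) ∧ inner ℝ q y = l1Norm Ω y := by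
  let s : Euc d → ℝ := fun x => if 0 ≤ y x then 1 else -1
  have hs : Measurable s := Measurable.ite
    (measurableSet_le measurable_const (Lp.stronglyMeasurable y).measurable)
    measurable_const measurable_const
  have hb : ∀ x, |s x| ≤ 1 := fun x => by
    by_cases h : 0 ≤ y x <;> simp [s, h]
  have hm : MemLp s 2 (volume.restrict Ω) :=
    MemLp.of_bound hs.aestronglyMeasurable 1 (Eventually.of_forall hb)
  have hle : ∀ᵐ x ∂(volume.restrict Ω), |hm.toLp s x| ≤ 1 := by
    filter_upwards [hm.coeFn_toLp] with x hx
    rw [hx]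
    exact hb x
  refine ⟨hm.toLp s, (forall_inner_le_l1Norm_iff _).2 hle, (inner_eq_l1Norm_iff hle).2 ?_⟩
  filter_upwards [hm.coeFn_toLp] with x hx
  rw [hx]
  by_cases h : 0 ≤ y x
  · simp [s, h, abs_of_nonneg h]
  · simp [s, h, abs_of_neg (not_le.1 h)]

theorem exists_isSlack (hd : 1 ≤ d) (hΩ : Bornology.IsBounded Ω) (ℓ : Hneg1 Ω) :
    ∃ (y : H01 Ω) (q : L2 Ω), IsSlack Ω ℓ y q := by
  obtain ⟨κ, hκ⟩ := exists_norm_le_mul_norm_gradL hd hΩ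
  have : CompleteSpace (H01 Ω) :=
    (Submodule.isClosed_topologicalClosure _).completeSpace_coe
  obtain ⟨y, q, h1, h2, h3⟩ := exists_primal_dual_pair (gradL Ω) (valL Ω) κ hκ (l1Norm Ω) _
    l1Norm_nonneg l1Norm_le ℓ
  have hq := (forall_inner_le_l1Norm_iff q).1 h2
  -- The sign of `y` is a competitor attaining the `L¹` norm, so the maximizer `q` attains it too.
  obtain ⟨q', hq', hq'y⟩ := exists_inner_eq_l1Norm (valL Ω y)
  have hqy := (inner_eq_l1Norm_iff hq).1 (le_antisymm (h2 _) (hq'y ▸ h3 q' hq'))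
  exact ⟨y, q, h1, hqy.and hq⟩

/-- `q` is a subgradient of the `L¹` norm at `y`: `(q, v) ≤ ‖v‖₁`, with equality for `v = y`. -/
theorem IsSlack.solvesVI {ℓ : Hneg1 Ω} {y : H01 Ω} {q : L2 Ω} (h : IsSlack Ω ℓ y q) :
    SolvesVI Ω ℓ y := by
  intro v
  have hq : ∀ᵐ x ∂(volume.restrict Ω), |q x| ≤ 1 := h.2.mono fun _ hx => hx.2
  have h1 := (forall_inner_le_l1Norm_iff q).2 hq (valL Ω v)
  have h2 := (inner_eq_l1Norm_iff hq).2 (h.2.mono fun _ hx => hx.1)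
  rw [← h.1, map_sub, inner_sub_right, h2]
  linarith

/-- The operators `S` and `Q` are well defined. -/
theorem isSlack_slack (hd : 1 ≤ d) (hΩ : Bornology.IsBounded Ω) (ℓ : Hneg1 Ω) :
    IsSlack Ω ℓ (solOp Ω ℓ) (slack Ω ℓ) := by
  obtain ⟨y, q, h⟩ := exists_isSlack hd hΩ ℓ
  -- `slack` is chosen relative to `solOp`, so the constructed state must first be identified with
  -- the chosen one.
  have hy : y = solOp Ω ℓ :=
    h.solvesVI.unique hd hΩ (Classical.epsilon_spec (p := SolvesVI Ω ℓ) ⟨y, h.solvesVI⟩)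
  exact Classical.epsilon_spec (p := IsSlack Ω ℓ (solOp Ω ℓ)) ⟨q, hy ▸ h⟩

end Slack

/-- With `M` empty the surface integral vanishes and `W_y` is all of `H₀¹(Ω)`, so every `v` is
admissible, in particular `y - ybar`. -/
theorem StrongStationarity.aForm_eq {d : ℕ} {Ω : Set (Euc d)} {ν : ℝ} {yd ud u : L2 Ω}
    {y : H01 Ω} {Y : Euc d → ℝ} {C : Set (Euc d)} {q : L2 Ω} {p : H01 Ω} {mu : Hneg1 Ω}
    (h : StrongStationarity Ω ν yd ud u y Y C q p mu) (hM : setM Ω Y = ∅) (v : H01 Ω) :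
    aForm Ω p v = inner ℝ (valL Ω y - yd) (valL Ω v) - mu v := by
  have ht : ∀ z : H01 Ω, HasTrace Ω (setM Ω Y) z 0 := fun z => hM ▸ hasTrace_empty z
  simpa [hM] using h.adjoint_eq v ⟨0, ht v, by simp [hM]⟩ 0 0 (ht p) (ht v)

end EllipticVI

theorem theorem5p3 {d : ℕ} (hd : 1 ≤ d)
    (Ω : Set (EllipticVI.Euc d)) (hΩ_open : IsOpen Ω) (hΩ_conn : IsConnected Ω)
    (hΩ_bdd : Bornology.IsBounded Ω)
    (ν : ℝ) (hν : 0 < ν)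
    (yd ud : EllipticVI.L2 Ω) (hud : MemLp ud ⊤ (volume.restrict Ω))
    (ubar : EllipticVI.L2 Ω)
    -- the state `ybar = S(ubar)` and its slack variable
    (ybar : EllipticVI.H01 Ω)
    (hybar : ybar = EllipticVI.solOp Ω (EllipticVI.l2ToDual Ω ubar))
    (qbar : EllipticVI.L2 Ω)
    (hqbar : qbar = EllipticVI.slack Ω (EllipticVI.l2ToDual Ω ubar))
    -- regularity: `Y` is a `C¹(Ω)` representative of `ybar`
    (Y : EllipticVI.Euc d → ℝ)
    (hY_rep : EllipticVI.valL Ω ybar =ᵐ[volume.restrict Ω] Y) (hY_C1 : ContDiffOn ℝ 1 Y Ω)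
    -- structure of the active set
    (C : Set (EllipticVI.Euc d)) (hC : EllipticVI.ActiveSetStructure Ω Y C)
    (hM : EllipticVI.setM Ω Y = ∅)
    -- strong stationarity
    (pbar : EllipticVI.H01 Ω) (mubar : EllipticVI.Hneg1 Ω)
    (hstat : EllipticVI.StrongStationarity Ω ν yd ud ubar ybar Y C qbar pbar mubar)
    -- sign condition
    (hsign : ∃ ε > (0 : ℝ), ∀ u : EllipticVI.L2 Ω, ‖u - ubar‖ ≤ ε →
      0 ≤ mubar (EllipticVI.solOp Ω (EllipticVI.l2ToDual Ω u) - ybar)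
        - (EllipticVI.slackOp Ω (EllipticVI.l2ToDual Ω u) - EllipticVI.l2ToDual Ω qbar) pbar) :
    EllipticVI.QuadraticGrowth Ω ν yd ud ubar := by
  obtain ⟨ε, hε, hsign⟩ := hsign
  have : IsFiniteMeasure (volume.restrict Ω) :=
    isFiniteMeasure_restrict.2 hΩ_bdd.measure_lt_top.ne
  refine ⟨ε, hε, ν / 2, by positivity, fun u hu => ?_⟩
  have hs := hsign u hu
  -- Both state equations are tested with the adjoint state.
  have eu := (EllipticVI.isSlack_slack hd hΩ_bdd (EllipticVI.l2ToDual Ω u)).1 pbar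
  have ebar := (EllipticVI.isSlack_slack hd hΩ_bdd (EllipticVI.l2ToDual Ω ubar)).1 pbar
  rw [EllipticVI.reducedObjective, EllipticVI.reducedObjective, ← hybar]
  rw [← hybar, ← hqbar] at ebar
  rw [EllipticVI.slackOp] at hs
  generalize EllipticVI.solOp Ω (EllipticVI.l2ToDual Ω u) = y at *
  generalize EllipticVI.slack Ω (EllipticVI.l2ToDual Ω u) = q at *
  have hp : EllipticVI.valL Ω pbar = -(ν • (ubar - ud)) :=
    eq_neg_of_add_eq_zero_left hstat.gradient_eq
  exact EllipticVI.objective_growth (EllipticVI.gradL Ω) (EllipticVI.valL Ω) hp eu ebar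
    (hstat.aForm_eq hM (y - ybar)) hs
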